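/- Let $F$ be a symmetric $p\times p$ and $G_k$ ($k\in[m]$) symmetric $q_k\times q_k$ matrices with entries in $\mathbb R[x_1,\dots,x_n]$, $K=\{x\in\mathbb R^n: G_k(x)\succeq0,\ k\in[m]\}$, and consider $$\lambda^\star=\inf_{x\in K}\lambda_{\min}(F(x)).\tag{P}$$ Let $d_k=\lceil\deg G_k/2\rceil$ (total degree) and $r\ge\max\{1,\lceil \deg F/2\rceil,d_1,\dots,d_m\}$. The correlative sparsity graph has vertex set $[n]$ and joins $i\neq j$ if $x_i,x_j$ occur in a common monomial of $F$, or both occur in some $G_k$. Let $I_1,\dots,I_t$ be its (distinct) maximal cliques, and let $[m]=J_1\sqcup\dots\sqcup J_t$ be a partition such that for $k\in J_\ell$ the matrix $G_k$ involves only variables $x_i$, $i\in I_\ell$. For a sequence $S=(S_\alpha)_{\alpha\in\mathbb N^n}$ of symmetric $p\times p$ matrices put $\mathscr L_S(\sum_\alpha P_\alpha x^\alpha)=\sum_\alpha \operatorname{tr}(P_\alpha S_\alpha)$. For $I\subseteq[n]$ let $M_d(S,I)$ and $M_d(GS,I)$ be the block matrices with blocks $S_{\alpha+\beta}$, respectively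 $\sum_\gamma S_{\alpha+\beta+\gamma}\otimes G_\gamma$, where $\alpha,\beta$ run over the exponents of total degree at most $d$ with support in $I$. The correlatively sparse relaxation is $$\lambda^{(\mathrm{cs})}_r=\inf_S\{\mathscr L_S(F): M_r(S,I_\ell)\succeq0\ (\ell\in[t]),\ M_{r-d_k}(G_kS,I_\ell)\succeq0\ (k\in J_\ell,\ \ell\in[t]),\ \mathscr L_S(I_p)=1\}.\tag{R}$$ Let $d_{K_\ell}=\max(\{1\}\cup\{d_k:k\in J_\ell\})$. The points extracted from $M_r(S,I)$ are defined as follows. Factor $M_r(S,I)=VV^{\mathsf T}$ with $V$ having $\operatorname{rank}M_r(S,I)$ columns; let $N_i$ ($i\in I$) be square matrices such that $V_{(\alpha+e_i,a)}=V_{(\alpha,a)}N_i$ for the rows of $V$, for all $a\in[p]$ and all exponents $\alpha$ of degree at most $r-1$ supported in $I$. The extracted points are the joint eigenvalues $(x_i)_{i\in I}\in\mathbb R^{I}$ of the $N_i$, i.e. those for which $N_iw=x_iw$ for all $i\in I$ and some $w\ne0$. Let $S$ be an optimal solution of (R) such that (i) $\operatorname{rank}S_0=1$; (ii) $\operatorname{rank}M_r(S,I_\ell)=\operatorname{rank}M_{r-d_{K_\ell}}(S,I_\ell)=:s_\ell$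 for every $\ell\in[t]$; (iii) $\operatorname{rank}M_r(S,I_i\cap I_j)=1$ for all $i\ne j$ with $I_i\cap I_j\neq\emptyset$. Then $\lambda_r^{(\mathrm{cs})}=\lambda^\star$. Moreover, for each $\ell$ the set $\Delta_\ell$ of points extracted from $M_r(S,I_\ell)$ has exactly $s_\ell$ elements; there is $v\in\mathbb R^p$ with $S_0=vv^{\mathsf T}$; and for every such $v$, each $\hat x\in\mathbb R^n$ with $(\hat x_i)_{i\in I_\ell}\in\Delta_\ell$ for all $\ell\in[t]$ is an optimal solution of (P), and $v$ is an eigenvector of $F(\hat x)$ for the eigenvalue $\lambda_{\min}(F(\hat x))$. -/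

import Mathlib

open Matrix
open scoped Kronecker

noncomputable section

namespace PMO

/-- Square matrices of size `p` whose entries are real polynomials in `x_0, …, x_{n-1}`. -/
abbrev PolyMat (n p : ℕ) := Matrix (Fin p) (Fin p) (MvPolynomial (Fin n) ℝ)

/-- The coefficient matrix `P_α` of `x^α` in `P(x) = ∑ P_α x^α`. -/
def coeffMat {n p : ℕ} (P : PolyMat n p) (α : Fin n →₀ ℕ) : Matrix (Fin p) (Fin p) ℝ :=
  P.map (MvPolynomial.coeff α)

/-- The real matrix `P(x)`. -/
def evalMat {n p : ℕ} (P : PolyMat n p) (x : Fin n → ℝ) : Matrix (Fin p) (Fin p) ℝ :=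
  P.map (MvPolynomial.eval x)

/-- The support of `P`: all `α` with `P_α ≠ 0` (see `mem_supp`). -/
def supp {n p : ℕ} (P : PolyMat n p) : Finset (Fin n →₀ ℕ) :=
  Finset.univ.biUnion fun i => Finset.univ.biUnion fun j => (P i j).support

theorem mem_supp {n p : ℕ} (P : PolyMat n p) (α : Fin n →₀ ℕ) :
    α ∈ supp P ↔ coeffMat P α ≠ 0 := by
  simp [supp, coeffMat, ← Matrix.ext_iff]

/-- The degree of `P`: the largest total degree of an entry. -/
def deg {n p : ℕ} (P : PolyMat n p) : ℕ :=
  Finset.univ.sup fun i => Finset.univ.sup fun j => (P i j).totalDegree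

/-- `⌈deg P / 2⌉`. -/
def halfDeg {n p : ℕ} (P : PolyMat n p) : ℕ := (deg P + 1) / 2

/-- The variables that effectively occur in `P`. -/
def vars {n p : ℕ} (P : PolyMat n p) : Finset (Fin n) :=
  Finset.univ.biUnion fun i => Finset.univ.biUnion fun j => (P i j).vars

/-- The smallest eigenvalue of a real symmetric matrix (of positive size). -/
def lambdaMin {p : ℕ} (A : Matrix (Fin p) (Fin p) ℝ) : ℝ :=
  sInf {μ : ℝ | Module.End.HasEigenvalue (Matrix.toLin' A) μ}

/-- The data of the problem `inf λ_min(F(x))` subject to `G_k(x) ⪰ 0` for all `k`. -/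
structure Problem (n p m : ℕ) where
  F : PolyMat n p
  F_symm : F.IsSymm
  q : Fin m → ℕ
  G : (k : Fin m) → PolyMat n (q k)
  G_symm : ∀ k, (G k).IsSymm

variable {n p m : ℕ}

/-- The feasible set `K` of the problem. -/
def Problem.K (P : Problem n p m) : Set (Fin n → ℝ) :=
  {x | ∀ k, (evalMat (P.G k) x).PosSemidef}

/-- The optimal value `λ*` (`+∞` if `K` is empty, `-∞` if unbounded below). -/
def Problem.optValue (P : Problem n p m) : EReal :=
  ⨅ x ∈ P.K, (lambdaMin (evalMat P.F x) : EReal)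

/-- `x` is an optimal solution of the problem. -/
def Problem.IsOptimalPoint (P : Problem n p m) (x : Fin n → ℝ) : Prop :=
  x ∈ P.K ∧ (lambdaMin (evalMat P.F x) : EReal) = P.optValue

/-- `r_min = max {⌈deg F / 2⌉, d_1, …, d_m}` with `d_k = ⌈deg G_k / 2⌉`. -/
def Problem.rMin (P : Problem n p m) : ℕ :=
  max (halfDeg P.F) (Finset.univ.sup fun k => halfDeg (P.G k))

/-- The correlative sparsity pattern graph. -/
def Problem.cspGraph (P : Problem n p m) : SimpleGraph (Fin n) where
  Adj i j := i ≠ j ∧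
    ((∃ α ∈ supp P.F, i ∈ α.support ∧ j ∈ α.support) ∨
      ∃ k, i ∈ vars (P.G k) ∧ j ∈ vars (P.G k))
  symm := ⟨fun _ _ h => ⟨h.1.symm, h.2.imp (fun ⟨α, h, h1, h2⟩ => ⟨α, h, h2, h1⟩)
    (fun ⟨k, h1, h2⟩ => ⟨k, h2, h1⟩)⟩⟩
  loopless := ⟨fun _ h => h.1 rfl⟩

/-- The list `I_1, …, I_t` of the maximal cliques of the correlative sparsity pattern graph,
together with a partition `J_1, …, J_t` of the constraints such that the constraints in `J_ℓ`
only involve variables in `I_ℓ`. -/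
structure Problem.CliqueDecomp (P : Problem n p m) where
  t : ℕ
  I : Fin t → Finset (Fin n)
  I_injective : Function.Injective I
  mem_range_I : ∀ C : Finset (Fin n), C ∈ Set.range I ↔
    Maximal (fun D : Finset (Fin n) => P.cspGraph.IsClique (D : Set (Fin n))) C
  J : Fin t → Finset (Fin m)
  J_disjoint : ∀ ℓ ℓ', ℓ ≠ ℓ' → Disjoint (J ℓ) (J ℓ')
  J_cover : ∀ k, ∃ ℓ, k ∈ J ℓ
  vars_subset : ∀ ℓ, ∀ k ∈ J ℓ, vars (P.G k) ⊆ I ℓ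

/-- Multi-indexed sequences `(S_α)` of `p × p` matrices. -/
abbrev MatSeq (n p : ℕ) := (Fin n →₀ ℕ) → Matrix (Fin p) (Fin p) ℝ

/-- The Riesz functional `L_S(P) = ∑_{α ∈ supp P} tr (P_α S_α)`. -/
def riesz (S : MatSeq n p) (P : PolyMat n p) : ℝ :=
  ∑ α ∈ supp P, (coeffMat P α * S α).trace

/-- The exponents `α` of total degree at most `d` with `supp α ⊆ I` (see `mem_exps`). -/
def exps (I : Finset (Fin n)) (d : ℕ) : Finset (Fin n →₀ ℕ) :=
  (Finset.range (d + 1)).biUnion fun k => Finset.finsuppAntidiag I k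

theorem mem_exps (I : Finset (Fin n)) (d : ℕ) (α : Fin n →₀ ℕ) :
    α ∈ exps I d ↔ α.degree ≤ d ∧ α.support ⊆ I := by
  simp only [exps, Finset.mem_biUnion, Finset.mem_range, Finset.mem_finsuppAntidiag,
    Nat.lt_succ_iff]
  have key : α.support ⊆ I → I.sum α = α.degree := fun h => by
    rw [Finsupp.degree_apply]
    exact (Finset.sum_subset h fun i _ hi => by simpa using hi).symm
  constructor
  · rintro ⟨k, hk, h, hI⟩
    exact ⟨(key hI) ▸ h ▸ hk, hI⟩
  · rintro ⟨h, hI⟩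
    exact ⟨_, h, key hI, hI⟩

/-- The moment matrix `M_d(S, I)`: its `(α, β)` block is `S_{α+β}`. -/
def momentMatrix (S : MatSeq n p) (I : Finset (Fin n)) (d : ℕ) :
    Matrix (exps I d × Fin p) (exps I d × Fin p) ℝ :=
  Matrix.of fun x y => S ((x.1 : Fin n →₀ ℕ) + (y.1 : Fin n →₀ ℕ)) x.2 y.2

/-- The localizing matrix `M_d(G S, I)`: its `(α, β)` block is
`∑_{γ ∈ supp G} S_{α+β+γ} ⊗ G_γ`. -/
def localizingMatrix {q : ℕ} (G : PolyMat n q) (S : MatSeq n p) (I : Finset (Fin n)) (d : ℕ) :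
    Matrix (exps I d × (Fin p × Fin q)) (exps I d × (Fin p × Fin q)) ℝ :=
  Matrix.of fun x y => (∑ γ ∈ supp G, S ((x.1 : Fin n →₀ ℕ) + (y.1 : Fin n →₀ ℕ) + γ) ⊗ₖ coeffMat G γ) x.2 y.2

variable {P : Problem n p m}

/-- `d_{K_ℓ}`: the maximum of `1` and of the numbers `⌈deg G_k / 2⌉`, `k ∈ J_ℓ`. -/
def Problem.CliqueDecomp.dK (D : P.CliqueDecomp) (ℓ : Fin D.t) : ℕ :=
  max 1 ((D.J ℓ).sup fun k => halfDeg (P.G k))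

/-- The feasible sequences of the `r`-th correlatively sparse moment relaxation. -/
def Problem.CliqueDecomp.csFeasible (D : P.CliqueDecomp) (r : ℕ) : Set (MatSeq n p) :=
  {S | (∀ α, (S α).IsSymm) ∧
    (∀ ℓ, (momentMatrix S (D.I ℓ) r).PosSemidef) ∧
    (∀ ℓ, ∀ k ∈ D.J ℓ,
      (localizingMatrix (P.G k) S (D.I ℓ) (r - halfDeg (P.G k))).PosSemidef) ∧
    riesz S 1 = 1}

/-- The value `λ_r^(cs)` of the `r`-th correlatively sparse moment relaxation. -/
def Problem.CliqueDecomp.csValue (D : P.CliqueDecomp) (r : ℕ) : EReal :=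
  ⨅ S ∈ D.csFeasible r, (riesz S P.F : EReal)

/-- `S` is an optimal solution of the `r`-th correlatively sparse moment relaxation. -/
def Problem.CliqueDecomp.IsCsOptimal (D : P.CliqueDecomp) (r : ℕ) (S : MatSeq n p) : Prop :=
  S ∈ D.csFeasible r ∧ ∀ S' ∈ D.csFeasible r, riesz S P.F ≤ riesz S' P.F

/-- One run of the linear-algebraic extraction procedure on `M = M_r(S, I)`: a factorization
`M = V Vᵀ` with `rank M` columns, and multiplication matrices `N_i`, `i ∈ I`, which map the row of
`V` at the monomial `x^α` to the row at `x_i x^α` whenever both have degree at most `r`.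
(Passing to another basis of the column space of `V`, such as its column echelon form, conjugates
all the `N_i` by the same invertible matrix.) -/
def IsExtractionRun (S : MatSeq n p) (I : Finset (Fin n)) (r : ℕ)
    (V : Matrix (exps I r × Fin p) (Fin (momentMatrix S I r).rank) ℝ)
    (N : I → Matrix (Fin (momentMatrix S I r).rank) (Fin (momentMatrix S I r).rank) ℝ) : Prop :=
  momentMatrix S I r = V * Vᵀ ∧
    ∀ (i : I) (α β : exps I r),
      (β : Fin n →₀ ℕ) = (α : Fin n →₀ ℕ) + Finsupp.single (i : Fin n) 1 →
        ∀ a : Fin p, V (β, a) = V (α, a) ᵥ* N i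

/-- The points `(x_i)_{i ∈ I}` extracted from `M_r(S, I)`: the joint eigenvalues of the
multiplication matrices. -/
def extractedPoints (S : MatSeq n p) (I : Finset (Fin n)) (r : ℕ) : Set (I → ℝ) :=
  {x | ∃ V N, IsExtractionRun S I r V N ∧ ∃ w, w ≠ 0 ∧ ∀ i, N i *ᵥ w = x i • w}

end PMO

end

namespace PMO

/-! ### Linear algebra -/

/-! On one clique, read the rows of a Gram factor `V` of the moment matrix as vectors indexed by
monomials times unit vectors of `ℝ^p`. Flatness says that rows of low degree already span, so
multiplication by `x_i` becomes a well-defined matrix `N_i`; the Hankel structure makes the `N_i`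
symmetric and commuting. In an orthonormal joint eigenbasis, and because `S 0 = v vᵀ`, the rows are
forced to be `v_a u_j x_j^α`. Hence on the clique `S` is `v vᵀ` times the moments of a probability
measure with weights `u_j ^ 2` at the extracted points (`exists_isAtomic`). Flatness over `d_K`
steps provides interpolation polynomials of degree low enough to test the localizing matrices, which
gives `G_k(x_j) ⪰ 0` (`IsAtomic.posSemidef_evalMat`).

Rank one on an overlap makes every shared coordinate have variance zero (`IsAtomic.seq_single_eq`),
so any choice `J` of one atom per clique glues to a point `z J`, which lies in `K`. Give `J` the
product of its weights. Each monomial of `F` lives in a single clique, so only marginals matter and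
`L_S(F)` is the mean of `vᵀ F(z J) v`; no ordering of the cliques is needed. Each term is at least
`λ_min(F(z J))`, which is at least `L_S(F)` because Dirac sequences at points of `K` are feasible
for the relaxation. A mean with positive weights of terms bounded below by the mean is constant, so
equality holds throughout. -/

theorem exists_mul_transpose_eq_of_posSemidef {ι : Type*} [Fintype ι] [DecidableEq ι]
    {M : Matrix ι ι ℝ} (hM : M.PosSemidef) :
    ∃ V : Matrix ι (Fin M.rank) ℝ, M = V * Vᵀ := by
  have hH := hM.isHermitian
  obtain ⟨e⟩ : Nonempty (Fin M.rank ≃ {i // hH.eigenvalues i ≠ 0}) := by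
    rw [hH.rank_eq_card_non_zero_eigs]
    exact ⟨(Fintype.equivFin _).symm⟩
  obtain ⟨U, hs⟩ : ∃ U : ι → ι → ℝ, ∀ i j, M i j = ∑ k, U i k * hH.eigenvalues k * U j k := by
    refine ⟨fun i j => (hH.eigenvectorUnitary : Matrix ι ι ℝ) i j, fun i j => ?_⟩
    conv_lhs => rw [hH.spectral_theorem, Unitary.conjStarAlgAut_apply]
    simp [Matrix.mul_apply, Matrix.diagonal_apply]
  refine ⟨Matrix.of fun i k => U i (e k) * Real.sqrt (hH.eigenvalues (e k)), ?_⟩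
  ext i j
  rw [hs, Matrix.mul_apply]
  have h1 : ∀ k, (Matrix.of fun i k => U i (e k) * Real.sqrt (hH.eigenvalues (e k))) i k *
      (Matrix.of fun i k => U i (e k) * Real.sqrt (hH.eigenvalues (e k)))ᵀ k j =
      U i (e k) * hH.eigenvalues (e k) * U j (e k) := by
    intro k
    have := Real.mul_self_sqrt (hM.eigenvalues_nonneg (e k))
    simp only [Matrix.of_apply, Matrix.transpose_apply]
    calc _ = U i (e k) * (√(hH.eigenvalues (e k)) * √(hH.eigenvalues (e k))) * U j (e k) := by ring
      _ = _ := by rw [this]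
  rw [Finset.sum_congr rfl fun k _ => h1 k,
    e.sum_comp fun k : {i // hH.eigenvalues i ≠ 0} => U i k * hH.eigenvalues k * U j k]
  rw [← Finset.sum_subtype (Finset.univ.filter fun i => hH.eigenvalues i ≠ 0) (by simp)
    fun k => U i k * hH.eigenvalues k * U j k, Finset.sum_filter_of_ne]
  intro k _ hk h0
  simp [h0] at hk

theorem exists_leftInverse_of_mulVec {ι κ : Type*} [Fintype ι] [Fintype κ] [DecidableEq ι]
    [DecidableEq κ] (A : Matrix ι κ ℝ) (h : ∀ w, A *ᵥ w = 0 → w = 0) :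
    ∃ B : Matrix κ ι ℝ, B * A = 1 := by
  obtain ⟨g, hg⟩ := (Matrix.toLin' A).exists_leftInverse_of_injective
    (LinearMap.ker_eq_bot'.2 fun w hw => h w (by simpa using hw))
  refine ⟨LinearMap.toMatrix' g, ?_⟩
  have := congrArg LinearMap.toMatrix' hg
  rwa [LinearMap.toMatrix'_comp, LinearMap.toMatrix'_toLin', LinearMap.toMatrix'_id] at this

/-- The joint eigenspaces of commuting symmetric operators form an orthogonal direct sum of the
whole space; concatenate orthonormal bases of the summands. -/
theorem exists_orthonormal_joint_eigenvectors {ι E : Type*} [NormedAddCommGroup E]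
    [InnerProductSpace ℝ E] [FiniteDimensional ℝ E] {s : ℕ} (hs : Module.finrank ℝ E = s)
    (T : ι → E →ₗ[ℝ] E) (hT : ∀ i, (T i).IsSymmetric) (hC : Pairwise (Function.onFun Commute T)) :
    ∃ (b : Fin s → E) (X : Fin s → ι → ℝ), Orthonormal ℝ b ∧ ∀ j i, T i (b j) = X j i • b j := by
  classical
  have hI := LinearMap.IsSymmetric.directSum_isInternal_of_pairwise_commute hT hC
  have hO := LinearMap.IsSymmetric.orthogonalFamily_iInf_eigenspaces hT
  generalize hW : (fun χ : ι → ℝ => (⨅ j, Module.End.eigenspace (T j) (χ j) : Submodule ℝ E)) = W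
    at hI
  have hO' : OrthogonalFamily ℝ (fun χ => W χ) fun χ => (W χ).subtypeₗᵢ := by
    subst hW
    exact hO
  have hm : ∀ χ, ∀ w ∈ W χ, ∀ i, T i w = χ i • w := by
    intro χ w hw i
    rw [← hW, Submodule.mem_iInf] at hw
    exact Module.End.mem_eigenspace_iff.1 (hw i)
  let b₀ : ∀ χ, Module.Basis _ ℝ (W χ) := fun χ => (stdOrthonormalBasis ℝ (W χ)).toBasis
  let b := hI.collectedBasis b₀
  have hb : Orthonormal ℝ b := hI.collectedBasis_orthonormal hO' fun χ => by simp [b₀]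
  have : Finite (Σ χ, Fin (Module.finrank ℝ (W χ))) := Module.Finite.finite_basis b
  have := Fintype.ofFinite (Σ χ, Fin (Module.finrank ℝ (W χ)))
  have hcard := Module.finrank_eq_card_basis b
  let e := (Fintype.equivFinOfCardEq (hcard.symm.trans hs)).symm
  refine ⟨b ∘ e, fun j => (e j).1, hb.comp _ e.injective, fun j i => ?_⟩
  exact hm _ _ (hI.collectedBasis_mem b₀ (e j)) i

theorem exists_simultaneous_diagonalization {ι : Type*} {s : ℕ}
    (N : ι → Matrix (Fin s) (Fin s) ℝ) (hsymm : ∀ i, (N i)ᵀ = N i)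
    (hcomm : ∀ i j, N i * N j = N j * N i) :
    ∃ (U : Matrix (Fin s) (Fin s) ℝ) (X : Fin s → ι → ℝ), U * Uᵀ = 1 ∧
      ∀ i, N i * U = U * Matrix.diagonal fun j => X j i := by
  have hT : ∀ i, (Matrix.toEuclideanLin (N i)).IsSymmetric := fun i => by
    rw [Matrix.isSymmetric_toEuclideanLin_iff, Matrix.IsHermitian,
      Matrix.conjTranspose_eq_transpose_of_trivial, hsymm]
  have hC : Pairwise (Function.onFun Commute fun i => Matrix.toEuclideanLin (N i)) := by
    intro i j _
    refine LinearMap.ext fun w => ?_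
    have := congrArg (fun A => A *ᵥ w.ofLp) (hcomm i j)
    simp only [← Matrix.mulVec_mulVec] at this
    simp [Matrix.toLpLin_apply, this]
  obtain ⟨b, X, hb, hX⟩ := exists_orthonormal_joint_eigenvectors finrank_euclideanSpace_fin _ hT hC
  have hU : (Matrix.of fun i j => b j i)ᵀ * (Matrix.of fun i j => b j i) = 1 := by
    ext i j
    have := orthonormal_iff_ite.1 hb j i
    rw [Matrix.one_apply, Matrix.mul_apply]
    simp only [eq_comm (a := i), ← this]
    simp [PiLp.inner_apply]
  refine ⟨Matrix.of fun i j => b j i, X, mul_eq_one_comm.1 hU, fun i => ?_⟩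
  ext k j
  have := congrArg (fun w => w.ofLp k) (hX j i)
  simp only [Matrix.toLpLin_apply] at this
  simp only [Matrix.mul_diagonal, Matrix.of_apply]
  simpa [Matrix.mul_apply, Matrix.mulVec, dotProduct, mul_comm] using this

theorem lambdaMin_mem {p : ℕ} (hp : 0 < p) {A : Matrix (Fin p) (Fin p) ℝ} (hA : A.IsSymm) :
    Module.End.HasEigenvalue (Matrix.toLin' A) (lambdaMin A) := by
  have hH : A.IsHermitian := by
    rw [Matrix.IsHermitian, Matrix.conjTranspose_eq_transpose_of_trivial, hA]
  have hfin : {μ : ℝ | Module.End.HasEigenvalue (Matrix.toLin' A) μ}.Finite :=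
    Module.End.finite_hasEigenvalue _
  have hne : {μ : ℝ | Module.End.HasEigenvalue (Matrix.toLin' A) μ}.Nonempty := by
    refine ⟨hH.eigenvalues ⟨0, hp⟩, ?_⟩
    refine Module.End.hasEigenvalue_of_hasEigenvector (x := (hH.eigenvectorBasis ⟨0, hp⟩).ofLp) ?_
    refine Module.End.hasEigenvector_iff.2 ⟨?_, ?_⟩
    · rw [Module.End.mem_eigenspace_iff, Matrix.toLin'_apply]
      simpa using hH.mulVec_eigenvectorBasis ⟨0, hp⟩
    · exact (WithLp.ofLp_eq_zero 2).ne.2 (hH.eigenvectorBasis.orthonormal.ne_zero _)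
  exact hne.csInf_mem hfin

theorem lambdaMin_le {p : ℕ} {A : Matrix (Fin p) (Fin p) ℝ} {μ : ℝ}
    (h : Module.End.HasEigenvalue (Matrix.toLin' A) μ) : lambdaMin A ≤ μ :=
  csInf_le (Module.End.finite_hasEigenvalue _).bddBelow h

theorem posSemidef_sub_lambdaMin {p : ℕ} {A : Matrix (Fin p) (Fin p) ℝ} (hA : A.IsSymm) :
    (A - lambdaMin A • 1).PosSemidef := by
  have hH : (A - lambdaMin A • 1).IsHermitian := by
    rw [Matrix.IsHermitian, Matrix.conjTranspose_eq_transpose_of_trivial]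
    simp [hA.eq]
  rw [hH.posSemidef_iff_eigenvalues_nonneg]
  intro i
  have h1 := hH.mulVec_eigenvectorBasis i
  have : Module.End.HasEigenvalue (Matrix.toLin' A) (lambdaMin A + hH.eigenvalues i) := by
    refine Module.End.hasEigenvalue_of_hasEigenvector (x := (hH.eigenvectorBasis i).ofLp) ?_
    refine Module.End.hasEigenvector_iff.2 ⟨?_, ?_⟩
    · rw [Module.End.mem_eigenspace_iff, Matrix.toLin'_apply]
      rw [Matrix.sub_mulVec, sub_eq_iff_eq_add] at h1
      rw [h1, Matrix.smul_mulVec, Matrix.one_mulVec, add_comm, add_smul]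
    · exact (WithLp.ofLp_eq_zero 2).ne.2 (hH.eigenvectorBasis.orthonormal.ne_zero _)
  simpa using lambdaMin_le this

theorem lambdaMin_le_dotProduct {p : ℕ} {A : Matrix (Fin p) (Fin p) ℝ} (hA : A.IsSymm)
    {v : Fin p → ℝ} (hv : v ⬝ᵥ v = 1) : lambdaMin A ≤ v ⬝ᵥ A *ᵥ v := by
  have := (posSemidef_sub_lambdaMin hA).dotProduct_mulVec_nonneg v
  simpa [Matrix.sub_mulVec, Matrix.smul_mulVec, dotProduct_sub, hv] using this

theorem hasEigenvector_lambdaMin {p : ℕ} {A : Matrix (Fin p) (Fin p) ℝ} (hA : A.IsSymm)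
    {v : Fin p → ℝ} (hv : v ⬝ᵥ v = 1) (h : v ⬝ᵥ A *ᵥ v = lambdaMin A) :
    Module.End.HasEigenvector (Matrix.toLin' A) (lambdaMin A) v := by
  have h0 := ((posSemidef_sub_lambdaMin hA).dotProduct_mulVec_zero_iff v).1
    (by simp [Matrix.sub_mulVec, Matrix.smul_mulVec, dotProduct_sub, hv, h])
  refine Module.End.hasEigenvector_iff.2 ⟨?_, ?_⟩
  · rw [Module.End.mem_eigenspace_iff, Matrix.toLin'_apply]
    rwa [Matrix.sub_mulVec, Matrix.smul_mulVec, Matrix.one_mulVec, sub_eq_zero] at h0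
  · rintro rfl
    simp at hv

theorem exists_unit_eigenvector {p : ℕ} (hp : 0 < p) {A : Matrix (Fin p) (Fin p) ℝ}
    (hA : A.IsSymm) : ∃ w : Fin p → ℝ, w ⬝ᵥ w = 1 ∧ w ⬝ᵥ A *ᵥ w = lambdaMin A := by
  obtain ⟨w, hw⟩ := (lambdaMin_mem hp hA).exists_hasEigenvector
  have h1 : A *ᵥ w = lambdaMin A • w := by simpa using hw.apply_eq_smul
  have h2 : 0 < w ⬝ᵥ w := by
    have := Matrix.dotProduct_star_self_pos_iff (v := w)
    simp only [star_trivial] at this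
    exact this.2 hw.2
  have h3 : (Real.sqrt (w ⬝ᵥ w))⁻¹ * ((Real.sqrt (w ⬝ᵥ w))⁻¹ * (w ⬝ᵥ w)) = 1 := by
    have := Real.mul_self_sqrt h2.le
    have h4 := (Real.sqrt_pos.2 h2).ne'
    field_simp
    linarith
  refine ⟨(Real.sqrt (w ⬝ᵥ w))⁻¹ • w, by simpa using h3, ?_⟩
  rw [Matrix.mulVec_smul, h1]
  simp only [smul_dotProduct, dotProduct_smul, smul_eq_mul]
  linear_combination lambdaMin A * h3

theorem minor_eq_zero_of_rank_le_one {ι : Type*} [Fintype ι] [DecidableEq ι] {M : Matrix ι ι ℝ}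
    (h : M.rank = 1) (i j : ι) : M i i * M j j = M i j * M j i := by
  have h1 : (M.submatrix ![i, j] ![i, j]).rank ≤ 1 := h ▸ rank_submatrix_le _ _ _
  by_contra h2
  have h3 : IsUnit (M.submatrix ![i, j] ![i, j]) := by
    rw [Matrix.isUnit_iff_isUnit_det, Matrix.det_fin_two]
    simpa [sub_eq_zero] using h2
  have := Matrix.rank_of_isUnit _ h3
  rw [Fintype.card_fin] at this
  omega

/-! ### Runs of the extraction procedure -/

section Runs

variable {n p : ℕ} {S : MatSeq n p} {I : Finset (Fin n)} {r d : ℕ}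

theorem exps_mono (I : Finset (Fin n)) {d e : ℕ} (h : d ≤ e) {α : Fin n →₀ ℕ}
    (hα : α ∈ exps I d) : α ∈ exps I e := by
  rw [mem_exps] at hα ⊢
  exact ⟨hα.1.trans h, hα.2⟩

theorem zero_mem_exps (I : Finset (Fin n)) (d : ℕ) : 0 ∈ exps I d := by
  simp [mem_exps]

theorem support_add_single_subset_iff {α : Fin n →₀ ℕ} {i : Fin n} :
    (α + Finsupp.single i 1).support ⊆ I ↔ α.support ⊆ I ∧ i ∈ I := by
  simp only [Finset.subset_iff, Finsupp.mem_support_iff, Finsupp.add_apply, Finsupp.single_apply]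
  constructor
  · exact fun h => ⟨fun j hj => h (by omega), h (by simp)⟩
  · intro h j hj
    by_cases hij : i = j
    · exact hij ▸ h.2
    · exact h.1 (by simpa [hij] using hj)

theorem add_single_mem_exps {α : Fin n →₀ ℕ} {i : Fin n} :
    α + Finsupp.single i 1 ∈ exps I (d + 1) ↔ α ∈ exps I d ∧ i ∈ I := by
  rw [mem_exps, mem_exps, support_add_single_subset_iff, map_add, Finsupp.degree_single]
  rw [Nat.add_le_add_iff_right, and_assoc]

theorem add_mem_exps {α β : Fin n →₀ ℕ} {e : ℕ} (hα : α ∈ exps I d) (hβ : β ∈ exps I e) :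
    α + β ∈ exps I (d + e) := by
  rw [mem_exps] at *
  refine ⟨by rw [map_add]; omega, ?_⟩
  exact Finsupp.support_add.trans (Finset.union_subset hα.2 hβ.2)

/-- Makes every `S γ` of degree at most `2d` a block of the moment matrix of order `d`. -/
theorem exists_add_of_mem_exps {γ : Fin n →₀ ℕ} (h : γ ∈ exps I (d + d)) :
    ∃ α ∈ exps I d, ∃ β ∈ exps I d, γ = α + β := by
  rw [mem_exps] at h
  obtain ⟨α, hα, hd⟩ := Finsupp.exists_le_degree_eq γ (min d γ.degree) (min_le_right _ _)
  obtain ⟨β, rfl⟩ := le_iff_exists_add.1 hα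
  rw [map_add] at h hd
  refine ⟨α, (mem_exps _ _ _).2 ⟨by omega, ?_⟩, β, (mem_exps _ _ _).2 ⟨by omega, ?_⟩, rfl⟩
  · exact (Finsupp.support_mono (self_le_add_right _ _)).trans h.2
  · exact (Finsupp.support_mono (self_le_add_left _ _)).trans h.2

theorem rank_momentMatrix_mono (S : MatSeq n p) (I : Finset (Fin n)) {d e : ℕ} (h : d ≤ e) :
    (momentMatrix S I d).rank ≤ (momentMatrix S I e).rank :=
  rank_submatrix_le (momentMatrix S I e)
    (fun x : exps I d × Fin p => (⟨x.1, exps_mono I h x.1.2⟩, x.2))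
    (fun x : exps I d × Fin p => (⟨x.1, exps_mono I h x.1.2⟩, x.2))

variable {κ : Type*} [Fintype κ]

theorem dotProduct_row {V : Matrix (exps I r × Fin p) κ ℝ} (hV : momentMatrix S I r = V * Vᵀ)
    (α β : exps I r) (a b : Fin p) :
    V (α, a) ⬝ᵥ V (β, b) = S ((α : Fin n →₀ ℕ) + (β : Fin n →₀ ℕ)) a b :=
  (congrFun (congrFun hV (α, a)) (β, b)).symm

/-- The form in which flatness is used: the rows of degree at most `d` are a Gram factor of the
smaller moment matrix, whose rank equals the number of columns, so they span. -/
theorem eq_zero_of_rows_dotProduct_eq_zero {V : Matrix (exps I r × Fin p) κ ℝ}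
    (hV : momentMatrix S I r = V * Vᵀ) (hd : d ≤ r)
    (hrank : Fintype.card κ = (momentMatrix S I d).rank) {w : κ → ℝ}
    (h : ∀ α (hα : α ∈ exps I d) a, V (⟨α, exps_mono I hd hα⟩, a) ⬝ᵥ w = 0) : w = 0 := by
  classical
  let V₁ : Matrix (exps I d × Fin p) κ ℝ := fun x => V (⟨x.1, exps_mono I hd x.1.2⟩, x.2)
  have h1 : momentMatrix S I d = V₁ * V₁ᵀ := by
    ext x y
    exact (dotProduct_row hV ⟨x.1, exps_mono I hd x.1.2⟩ ⟨y.1, exps_mono I hd y.1.2⟩ x.2 y.2).symm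
  have h2 : V₁.rank = Fintype.card κ := by
    rw [hrank, h1, Matrix.rank_self_mul_transpose]
  have h3 := LinearMap.finrank_range_add_finrank_ker V₁.mulVecLin
  rw [Module.finrank_fintype_fun_eq_card] at h3
  have h4 : Module.finrank ℝ (LinearMap.ker V₁.mulVecLin) = 0 := by
    have : Module.finrank ℝ (LinearMap.range V₁.mulVecLin) = Fintype.card κ := h2
    omega
  have h5 : w ∈ LinearMap.ker V₁.mulVecLin := by
    rw [LinearMap.mem_ker, Matrix.mulVecLin_apply]
    funext x
    exact h x.1 x.1.2 x.2
  rwa [Submodule.finrank_eq_zero.1 h4, Submodule.mem_bot] at h5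

theorem eq_of_rows_dotProduct_mulVec_eq {V : Matrix (exps I r × Fin p) κ ℝ}
    (hV : momentMatrix S I r = V * Vᵀ) (hd : d ≤ r)
    (hrank : Fintype.card κ = (momentMatrix S I d).rank) {A B : Matrix κ κ ℝ}
    (h : ∀ α (hα : α ∈ exps I d) a β (hβ : β ∈ exps I d) b,
      V (⟨α, exps_mono I hd hα⟩, a) ⬝ᵥ A *ᵥ V (⟨β, exps_mono I hd hβ⟩, b) =
      V (⟨α, exps_mono I hd hα⟩, a) ⬝ᵥ B *ᵥ V (⟨β, exps_mono I hd hβ⟩, b)) : A = B := by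
  have h1 : ∀ β (hβ : β ∈ exps I d) b,
      (A - B) *ᵥ V (⟨β, exps_mono I hd hβ⟩, b) = 0 := fun β hβ b =>
    eq_zero_of_rows_dotProduct_eq_zero hV hd hrank fun α hα a => by
      rw [Matrix.sub_mulVec, dotProduct_sub, h α hα a β hβ b, sub_self]
  rw [← sub_eq_zero]
  ext i j
  have := eq_zero_of_rows_dotProduct_eq_zero hV hd hrank (w := (A - B) i) fun β hβ b => by
    rw [dotProduct_comm]
    exact congrFun (h1 β hβ b) i
  exact congrFun this j

theorem exists_isExtractionRun (hM : (momentMatrix S I r).PosSemidef)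
    (hflat : (momentMatrix S I r).rank = (momentMatrix S I (r - 1)).rank) (hr : 1 ≤ r) :
    ∃ V N, IsExtractionRun S I r V N := by
  obtain ⟨V, hV⟩ := exists_mul_transpose_eq_of_posSemidef hM
  obtain ⟨d, rfl⟩ : ∃ d, r = d + 1 := ⟨r - 1, by omega⟩
  rw [Nat.add_sub_cancel] at hflat
  let V₁ : Matrix (exps I d × Fin p) _ ℝ := fun x => V (⟨x.1, exps_mono I d.le_succ x.1.2⟩, x.2)
  let W : I → Matrix (exps I d × Fin p) _ ℝ := fun i x =>
    V (⟨(x.1 : Fin n →₀ ℕ) + Finsupp.single (i : Fin n) 1, add_single_mem_exps.2 ⟨x.1.2, i.2⟩⟩, x.2)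
  obtain ⟨L, hL⟩ := exists_leftInverse_of_mulVec V₁ fun w hw =>
    eq_zero_of_rows_dotProduct_eq_zero hV d.le_succ (by simpa using hflat)
      fun α hα a => congrFun hw (⟨α, hα⟩, a)
  have hsymm : ∀ i, W i * V₁ᵀ = V₁ * (W i)ᵀ := by
    intro i
    ext x y
    refine (dotProduct_row hV _ _ _ _).trans (Eq.trans ?_ (dotProduct_row hV _ _ _ _).symm)
    simp only [add_right_comm, add_assoc]
  -- The columns of `W i` lie in the column space of `V₁`: the Hankel symmetry `hsymm` gives this
  -- for `W i * V₁ᵀ`, and `V₁ᵀ` has a right inverse. On that space `V₁ * L` is the identity.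
  have hN : ∀ i, V₁ * (L * W i) = W i := by
    intro i
    have h1 : (V₁ * L - 1) * V₁ = 0 := by
      rw [Matrix.sub_mul, Matrix.mul_assoc, hL, Matrix.mul_one, Matrix.one_mul, sub_self]
    have h2 : V₁ᵀ * Lᵀ = 1 := by rw [← Matrix.transpose_mul, hL, Matrix.transpose_one]
    have h3 : (V₁ * L - 1) * W i = 0 := by
      rw [← Matrix.mul_one (W i), ← h2, ← Matrix.mul_assoc, ← Matrix.mul_assoc,
        Matrix.mul_assoc _ (W i), hsymm, ← Matrix.mul_assoc, h1, Matrix.zero_mul, Matrix.zero_mul]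
    rwa [Matrix.sub_mul, Matrix.one_mul, Matrix.mul_assoc, sub_eq_zero] at h3
  refine ⟨V, fun i => L * W i, hV, ?_⟩
  rintro i ⟨α, hα⟩ ⟨β, hβ⟩ h a
  obtain rfl : β = α + Finsupp.single (i : Fin n) 1 := h
  exact (congrFun (hN i) (⟨α, (add_single_mem_exps.1 hβ).1⟩, a)).symm

/-- A factorization of the moment matrix together with matrices that shift its rows. -/
structure IsShiftRun (S : MatSeq n p) (I : Finset (Fin n)) (d : ℕ)
    (V : Matrix (exps I (d + 1) × Fin p) κ ℝ) (N : I → Matrix κ κ ℝ) : Prop where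
  factor : momentMatrix S I (d + 1) = V * Vᵀ
  card_eq : Fintype.card κ = (momentMatrix S I d).rank
  shift : ∀ (i : I) (α : Fin n →₀ ℕ) (hα : α ∈ exps I d) (a : Fin p),
    V (⟨α + Finsupp.single (i : Fin n) 1, add_single_mem_exps.2 ⟨hα, i.2⟩⟩, a) =
      V (⟨α, exps_mono I d.le_succ hα⟩, a) ᵥ* N i

theorem IsExtractionRun.isShiftRun {V N} (h : IsExtractionRun S I (d + 1) V N)
    (hflat : (momentMatrix S I (d + 1)).rank = (momentMatrix S I d).rank) :
    IsShiftRun S I d V N where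
  factor := h.1
  card_eq := by simpa using hflat
  shift i α hα a := h.2 i ⟨α, exps_mono I d.le_succ hα⟩
    ⟨α + Finsupp.single (i : Fin n) 1, add_single_mem_exps.2 ⟨hα, i.2⟩⟩ rfl a

namespace IsShiftRun

variable {V : Matrix (exps I (d + 1) × Fin p) κ ℝ} {N : I → Matrix κ κ ℝ}

/-- Between spanning rows, both sides evaluate to the entry of `S` at `α + β + e_i`. -/
theorem transpose_eq (h : IsShiftRun S I d V N) (i : I) : (N i)ᵀ = N i := by
  refine eq_of_rows_dotProduct_mulVec_eq h.factor d.le_succ h.card_eq fun α hα a β hβ b => ?_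
  rw [Matrix.mulVec_transpose, ← h.shift i β hβ, dotProduct_mulVec, ← h.shift i α hα,
    dotProduct_row h.factor, dotProduct_row h.factor]
  simp only [add_right_comm, add_assoc]

theorem mul_right_comm (h : IsShiftRun S I d V N) (i j : I) : N i * N j = N j * N i := by
  -- One shift is moved to each row, so neither leaves degree `d + 1`.
  have key : ∀ i j, ∀ α (hα : α ∈ exps I d) a β (hβ : β ∈ exps I d) b,
      V (⟨α, exps_mono I d.le_succ hα⟩, a) ⬝ᵥ (N i * N j) *ᵥ V (⟨β, exps_mono I d.le_succ hβ⟩, b) =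
        S (α + Finsupp.single (i : Fin n) 1 + (β + Finsupp.single (j : Fin n) 1)) a b := by
    intro i j α hα a β hβ b
    rw [← Matrix.mulVec_mulVec, dotProduct_mulVec, ← h.shift i α hα, ← h.transpose_eq j,
      Matrix.mulVec_transpose, ← h.shift j β hβ, dotProduct_row h.factor]
  refine eq_of_rows_dotProduct_mulVec_eq h.factor d.le_succ h.card_eq fun α hα a β hβ b => ?_
  have e : α + Finsupp.single (i : Fin n) 1 + (β + Finsupp.single (j : Fin n) 1) =
      α + Finsupp.single (j : Fin n) 1 + (β + Finsupp.single (i : Fin n) 1) := by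
    abel
  rw [key i j α hα a β hβ b, key j i α hα a β hβ b, e]

theorem exists_diagonal {s : ℕ} {V : Matrix (exps I (d + 1) × Fin p) (Fin s) ℝ}
    {N : I → Matrix (Fin s) (Fin s) ℝ} (h : IsShiftRun S I d V N) :
    ∃ (W : Matrix (exps I (d + 1) × Fin p) (Fin s) ℝ) (X : Fin s → I → ℝ),
      IsShiftRun S I d W fun i => Matrix.diagonal fun j => X j i := by
  obtain ⟨U, X, hU, hX⟩ := exists_simultaneous_diagonalization N h.transpose_eq h.mul_right_comm
  refine ⟨V * U, X, ?_, h.card_eq, ?_⟩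
  · rw [Matrix.transpose_mul, Matrix.mul_assoc, ← Matrix.mul_assoc U, hU, Matrix.one_mul, h.factor]
  · intro i α hα a
    have h1 : ∀ x, (V * U) x = V x ᵥ* U := fun _ => rfl
    rw [h1, h1, h.shift i α hα, Matrix.vecMul_vecMul, hX, Matrix.vecMul_vecMul]

/-- Joint eigenvalues do not depend on the run: two Gram factors of the same matrix have the same
column space, so `V' = V * (L * V')`, and `L * V'` transports eigenvectors. -/
theorem exists_eigenvector {κ' : Type*} [Fintype κ'] {V' : Matrix (exps I (d + 1) × Fin p) κ' ℝ}
    {N' : I → Matrix κ' κ' ℝ} (h : IsShiftRun S I d V N) (h' : IsShiftRun S I d V' N')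
    {x : I → ℝ} {w : κ' → ℝ} (hw : w ≠ 0) (hx : ∀ i, N' i *ᵥ w = x i • w) :
    ∃ z, z ≠ 0 ∧ ∀ i, N i *ᵥ z = x i • z := by
  classical
  obtain ⟨L, hL⟩ := exists_leftInverse_of_mulVec V fun w hw =>
    eq_zero_of_rows_dotProduct_eq_zero h.factor d.le_succ h.card_eq
      fun α hα a => congrFun hw (⟨α, exps_mono I d.le_succ hα⟩, a)
  obtain ⟨L', hL'⟩ := exists_leftInverse_of_mulVec V' fun w hw =>
    eq_zero_of_rows_dotProduct_eq_zero h'.factor d.le_succ h'.card_eq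
      fun α hα a => congrFun hw (⟨α, exps_mono I d.le_succ hα⟩, a)
  have h2 : V'ᵀ * L'ᵀ = 1 := by rw [← Matrix.transpose_mul, hL', Matrix.transpose_one]
  have hQ : V * (L * V') = V' := by
    rw [← Matrix.mul_one V', ← h2, ← Matrix.mul_assoc V', ← h'.factor, h.factor]
    simp only [← Matrix.mul_assoc]
    rw [Matrix.mul_assoc V L V, hL, Matrix.mul_one]
  have hz : V *ᵥ ((L * V') *ᵥ w) = V' *ᵥ w := by rw [Matrix.mulVec_mulVec, hQ]
  have hrow : ∀ y, V y ⬝ᵥ ((L * V') *ᵥ w) = V' y ⬝ᵥ w := fun y => congrFun hz y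
  refine ⟨(L * V') *ᵥ w, fun h0 => hw ?_, fun i => sub_eq_zero.1 ?_⟩
  · rw [h0, Matrix.mulVec_zero] at hz
    rw [← Matrix.one_mulVec w, ← hL', ← Matrix.mulVec_mulVec, ← hz, Matrix.mulVec_zero]
  · refine eq_zero_of_rows_dotProduct_eq_zero h.factor d.le_succ h.card_eq fun α hα a => ?_
    rw [dotProduct_sub, dotProduct_mulVec, ← h.shift i α hα, hrow, dotProduct_smul, hrow,
      h'.shift i α hα, ← dotProduct_mulVec, hx, dotProduct_smul, sub_self]

end IsShiftRun

end Runs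

/-! ### Monomials -/

section Monomials

variable {n : ℕ}

/-- The value of the monomial `x^α` at a point. -/
def mono (x : Fin n → ℝ) (α : Fin n →₀ ℕ) : ℝ := α.prod fun i k => x i ^ k

theorem mono_zero (x : Fin n → ℝ) : mono x 0 = 1 := Finsupp.prod_zero_index

theorem mono_add (x : Fin n → ℝ) (α β : Fin n →₀ ℕ) : mono x (α + β) = mono x α * mono x β :=
  Finsupp.prod_add_index' (fun _ => pow_zero _) fun _ _ _ => pow_add _ _ _

theorem mono_single (x : Fin n → ℝ) (i : Fin n) : mono x (Finsupp.single i 1) = x i := by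
  simp [mono]

theorem mono_congr {x y : Fin n → ℝ} {α : Fin n →₀ ℕ} (h : ∀ i ∈ α.support, x i = y i) :
    mono x α = mono y α :=
  Finset.prod_congr rfl fun i hi => by simp only [h i hi]

theorem exists_eq_add_single {α : Fin n →₀ ℕ} (h : α ≠ 0) :
    ∃ β i, α = β + Finsupp.single i 1 := by
  obtain ⟨i, hi⟩ := Finsupp.ne_iff.1 h
  exact ⟨α - Finsupp.single i 1, i, (tsub_add_cancel_of_le
    (Finsupp.single_le_iff.2 (Nat.one_le_iff_ne_zero.2 hi))).symm⟩

end Monomials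

/-! ### Atoms of a flat rank-one sequence -/

section Atoms

variable {n p : ℕ} {S : MatSeq n p} {I : Finset (Fin n)} {r d s : ℕ} {v : Fin p → ℝ}

theorem exists_unit_row_of_gram {s p : ℕ} {V : Fin p → Fin s → ℝ} {v : Fin p → ℝ}
    (hv : v ⬝ᵥ v = 1) (h : ∀ a b, V a ⬝ᵥ V b = v a * v b) :
    ∃ u : Fin s → ℝ, ∀ a, V a = v a • u := by
  have h1 : ∀ w, (∑ b, v b • V b) ⬝ᵥ w = ∑ b, v b * (V b ⬝ᵥ w) := fun w => by
    simp only [sum_dotProduct, smul_dotProduct, smul_eq_mul]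
  have hv' : ∑ b, v b * v b = 1 := hv
  have h2 : ∀ a, (∑ b, v b • V b) ⬝ᵥ V a = v a := fun a => by
    rw [h1, Finset.sum_congr rfl fun b _ => by rw [h, ← mul_assoc], ← Finset.sum_mul, hv', one_mul]
  have h3 : (∑ b, v b • V b) ⬝ᵥ (∑ b, v b • V b) = 1 := by
    rw [h1, Finset.sum_congr rfl fun b _ => by rw [dotProduct_comm, h2], hv']
  -- The only candidate for `u`, since `v` is a unit vector; the Gram data show that `V a - v a • u`
  -- has norm zero.
  refine ⟨∑ b, v b • V b, fun a => sub_eq_zero.1 (dotProduct_self_eq_zero.1 ?_)⟩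
  simp only [sub_dotProduct, dotProduct_sub, smul_dotProduct, dotProduct_smul, h2, h3,
    dotProduct_comm (V a) (∑ b, v b • V b), h, smul_eq_mul]
  ring

/-- The rows at the monomial `1` are `v a • u` because `S 0` has rank one; each diagonal shift
multiplies coordinate `j` by `x j i`. -/
theorem IsShiftRun.exists_row_eq {V : Matrix (exps I (d + 1) × Fin p) (Fin s) ℝ}
    {x : Fin s → Fin n → ℝ}
    (h : IsShiftRun S I d V fun i => Matrix.diagonal fun j => x j i)
    (hS : S 0 = Matrix.vecMulVec v v) (hv : v ⬝ᵥ v = 1) :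
    ∃ u : Fin s → ℝ, ∀ α (hα : α ∈ exps I (d + 1)) a j,
      V (⟨α, hα⟩, a) j = v a * u j * mono (x j) α := by
  obtain ⟨u, hu⟩ := exists_unit_row_of_gram (V := fun a => V (⟨0, zero_mem_exps I _⟩, a)) hv
    fun a b => by
      rw [dotProduct_row h.factor]
      simp [hS, Matrix.vecMulVec_apply]
  refine ⟨u, ?_⟩
  have key : ∀ k, ∀ α (hα : α ∈ exps I (d + 1)), α.degree = k →
      ∀ a j, V (⟨α, hα⟩, a) j = v a * u j * mono (x j) α := by
    intro k
    induction k with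
    | zero =>
      intro α hα h0 a j
      obtain rfl := (Finsupp.degree_eq_zero_iff α).1 h0
      have := congrFun (hu a) j
      simpa [mono_zero] using this
    | succ k ih =>
      intro α hα hk a j
      obtain ⟨β, i, rfl⟩ := exists_eq_add_single (α := α) (by rintro rfl; simp at hk)
      obtain ⟨hβ, hi⟩ := add_single_mem_exps.1 hα
      rw [map_add, Finsupp.degree_single, Nat.add_right_cancel_iff] at hk
      have h1 := congrFun (h.shift ⟨i, hi⟩ β hβ a) j
      rw [Matrix.vecMul_diagonal, ih β _ hk] at h1
      rw [h1, mono_add, mono_single]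
      ring
  exact fun α hα => key _ α hα rfl

/-- The points `x_j` with the weights `c_j > 0` represent the sequence `S = y • v vᵀ` on the
exponents of degree at most `2r` supported in `I`; the `x_j` are the extracted points, and they
are separated by the polynomials of degree at most `e`. -/
structure IsAtomic (S : MatSeq n p) (I : Finset (Fin n)) (r e : ℕ) (v : Fin p → ℝ)
    (x : Fin s → Fin n → ℝ) (c : Fin s → ℝ) : Prop where
  pos : ∀ j, 0 < c j
  seq_eq : ∀ α ∈ exps I (r + r), S α = (∑ j, c j * mono (x j) α) • Matrix.vecMulVec v v
  exists_interpolation : ∀ j, ∃ f : exps I e → ℝ, ∀ i,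
    ∑ α, f α * mono (x i) α = if i = j then 1 else 0
  mem_extractedPoints : ∀ y, y ∈ extractedPoints S I r ↔ ∃ j, y = fun i : I => x j i

theorem exists_isAtomic {e : ℕ} (hM : (momentMatrix S I r).PosSemidef) (hr : e + 1 ≤ r)
    (hflat : (momentMatrix S I r).rank = (momentMatrix S I e).rank)
    (hS : S 0 = Matrix.vecMulVec v v) (hv : v ⬝ᵥ v = 1) :
    ∃ (x : Fin (momentMatrix S I r).rank → Fin n → ℝ) (c : Fin (momentMatrix S I r).rank → ℝ),
      IsAtomic S I r e v x c := by
  obtain ⟨d, rfl⟩ : ∃ d, r = d + 1 := ⟨r - 1, by omega⟩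
  have hflat' : (momentMatrix S I (d + 1)).rank = (momentMatrix S I d).rank :=
    le_antisymm (hflat ▸ rank_momentMatrix_mono S I (by omega))
      (rank_momentMatrix_mono S I d.le_succ)
  obtain ⟨V₀, N₀, h₀⟩ := exists_isExtractionRun hM hflat' (by omega)
  obtain ⟨V, X, h⟩ := (h₀.isShiftRun hflat').exists_diagonal
  obtain ⟨x, hx⟩ : ∃ x : Fin (momentMatrix S I (d + 1)).rank → Fin n → ℝ,
      ∀ j (i : I), X j i = x j i :=
    ⟨fun j i => if hi : i ∈ I then X j ⟨i, hi⟩ else 0, fun j i => by simp⟩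
  simp only [hx] at h
  obtain ⟨u, hu⟩ := h.exists_row_eq hS hv
  have hker := fun w => eq_zero_of_rows_dotProduct_eq_zero h.factor (d := e) (w := w) (by omega)
    (by simpa using hflat)
  -- If `u j = 0`, column `j` of `V` vanishes, contradicting the spanning of the rows.
  have hu0 : ∀ j, u j ≠ 0 := by
    intro j hj
    have := hker (Pi.single j 1) fun α hα a => by
      rw [dotProduct_single, hu, hj]
      simp
    simpa using congrFun this j
  obtain ⟨a, ha⟩ : ∃ a, v a ≠ 0 := by
    by_contra! h0
    simp [dotProduct, h0] at hv
  refine ⟨x, fun j => u j ^ 2, fun j => by have := hu0 j; positivity, ?_, ?_, ?_⟩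
  · intro γ hγ
    obtain ⟨α, hα, β, hβ, rfl⟩ := exists_add_of_mem_exps hγ
    ext a b
    rw [← dotProduct_row h.factor ⟨α, hα⟩ ⟨β, hβ⟩, dotProduct]
    simp only [hu, Matrix.smul_apply, Matrix.vecMulVec_apply, smul_eq_mul, Finset.sum_mul, mono_add]
    exact Finset.sum_congr rfl fun j _ => by ring
  · let A : Matrix (exps I e) (Fin (momentMatrix S I (d + 1)).rank) ℝ :=
      Matrix.of fun α j => mono (x j) α
    -- Rescaling by `u j` turns a linear relation among the evaluations at the atoms into a vector
    -- orthogonal to all rows of degree at most `e`. Row `j` of the left inverse `B` holds the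
    -- coefficients of the interpolation polynomial at `x j`.
    obtain ⟨B, hB⟩ := exists_leftInverse_of_mulVec A fun w hw => by
      have h1 := hker (fun j => w j / u j) fun α hα a => by
        have h2 := congrFun hw ⟨α, hα⟩
        simp only [A, Matrix.mulVec, dotProduct, Matrix.of_apply, Pi.zero_apply] at h2
        simp only [dotProduct, hu]
        rw [← mul_zero (v a), ← h2, Finset.mul_sum]
        refine Finset.sum_congr rfl fun j _ => ?_
        have := hu0 j
        field_simp
      funext j
      have h3 := congrFun h1 j
      simpa [hu0 j] using h3
    refine fun j => ⟨B j, fun i => ?_⟩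
    have := congrFun (congrFun hB j) i
    rw [Matrix.one_apply] at this
    simp only [eq_comm (a := i)]
    exact this
  · intro y
    constructor
    · rintro ⟨V', N', h', w, hw, hy⟩
      obtain ⟨z, hz, hzy⟩ := h.exists_eigenvector (h'.isShiftRun hflat') hw hy
      obtain ⟨j, hj⟩ := Function.ne_iff.1 hz
      refine ⟨j, funext fun i => ?_⟩
      have := congrFun (hzy i) j
      rw [Matrix.mulVec_diagonal] at this
      exact (mul_right_cancel₀ hj this).symm
    · rintro ⟨j, rfl⟩
      refine ⟨V, fun i => Matrix.diagonal fun j => x j i, ⟨h.factor, ?_⟩, Pi.single j 1, by simp,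
        fun i => ?_⟩
      · rintro i ⟨α, hα⟩ ⟨β, hβ⟩ hαβ a
        obtain rfl : β = α + Finsupp.single (i : Fin n) 1 := hαβ
        exact h.shift i α (add_single_mem_exps.1 hβ).1 a
      · ext k
        by_cases hk : k = j
        · subst hk
          simp
        · simp [hk]

namespace IsAtomic

variable {e : ℕ} {x : Fin s → Fin n → ℝ} {c : Fin s → ℝ}

theorem injective_restrict (h : IsAtomic S I r e v x c) :
    Function.Injective fun (j : Fin s) (i : I) => x j i := by
  intro j k hjk
  obtain ⟨f, hf⟩ := h.exists_interpolation j
  have h1 : ∀ α : exps I e, mono (x j) α = mono (x k) α := fun α =>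
    mono_congr fun i hi => congrFun hjk ⟨i, ((mem_exps _ _ _).1 α.2).2 hi⟩
  have h2 := hf j
  rw [if_pos rfl, Finset.sum_congr rfl fun α _ => by rw [h1 α], hf k] at h2
  by_contra hne
  rw [if_neg (Ne.symm hne)] at h2
  exact zero_ne_one h2

theorem extractedPoints_eq (h : IsAtomic S I r e v x c) :
    extractedPoints S I r = Set.range fun (j : Fin s) (i : I) => x j i := by
  ext y
  rw [h.mem_extractedPoints]
  simp [eq_comm]

theorem ncard_extractedPoints (h : IsAtomic S I r e v x c) :
    (extractedPoints S I r).ncard = s := by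
  rw [h.extractedPoints_eq, ← Set.image_univ, Set.ncard_image_of_injective _ h.injective_restrict,
    Set.ncard_univ, Nat.card_eq_fintype_card, Fintype.card_fin]

theorem sum_eq_one (h : IsAtomic S I r e v x c) (hS : S 0 = Matrix.vecMulVec v v)
    (hv : v ⬝ᵥ v = 1) : ∑ j, c j = 1 := by
  have h1 := congrArg Matrix.trace (h.seq_eq 0 (zero_mem_exps _ _))
  rw [hS, Matrix.trace_smul, Matrix.trace_vecMulVec, hv] at h1
  simpa [mono_zero] using h1.symm

end IsAtomic

end Atoms

/-! ### Evaluation of polynomial matrices -/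

section PolynomialMatrices

variable {n p q : ℕ}

theorem evalMat_eq_sum (P : PolyMat n p) (x : Fin n → ℝ) :
    evalMat P x = ∑ γ ∈ supp P, mono x γ • coeffMat P γ := by
  ext i j
  rw [Matrix.sum_apply]
  simp only [evalMat, Matrix.map_apply, Matrix.smul_apply, coeffMat, smul_eq_mul]
  rw [MvPolynomial.eval_eq]
  refine Finset.sum_subset_zero_on_sdiff ?_ ?_ fun γ _ => _root_.mul_comm _ _
  · intro γ hγ
    simp only [supp, Finset.mem_biUnion, Finset.mem_univ, true_and]
    exact ⟨i, j, hγ⟩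
  · intro γ hγ
    rw [MvPolynomial.notMem_support_iff.1 (Finset.mem_sdiff.1 hγ).2, mul_zero]

theorem evalMat_isSymm {P : PolyMat n p} (hP : P.IsSymm) (x : Fin n → ℝ) :
    (evalMat P x).IsSymm := by
  rw [Matrix.IsSymm, evalMat, ← Matrix.transpose_map, hP.eq]

theorem evalMat_one (x : Fin n → ℝ) : evalMat (1 : PolyMat n p) x = 1 := by
  simp [evalMat]

theorem degree_le_deg {P : PolyMat n p} {γ : Fin n →₀ ℕ} (h : γ ∈ supp P) : γ.degree ≤ deg P := by
  simp only [supp, Finset.mem_biUnion, Finset.mem_univ, true_and] at h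
  obtain ⟨i, j, h⟩ := h
  calc γ.degree ≤ (P i j).totalDegree := MvPolynomial.le_totalDegree h
    _ ≤ Finset.univ.sup fun j => (P i j).totalDegree :=
      Finset.le_sup (f := fun j => (P i j).totalDegree) (Finset.mem_univ j)
    _ ≤ deg P := Finset.le_sup (f := fun i => Finset.univ.sup fun j => (P i j).totalDegree)
      (Finset.mem_univ i)

theorem deg_le_two_mul_halfDeg (P : PolyMat n p) : deg P ≤ halfDeg P + halfDeg P := by
  unfold halfDeg
  omega

theorem support_subset_vars {P : PolyMat n p} {γ : Fin n →₀ ℕ} (h : γ ∈ supp P) :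
    γ.support ⊆ vars P := by
  simp only [supp, Finset.mem_biUnion, Finset.mem_univ, true_and] at h
  obtain ⟨i, j, h⟩ := h
  intro k hk
  simp only [vars, Finset.mem_biUnion, Finset.mem_univ, true_and]
  exact ⟨i, j, (MvPolynomial.mem_vars_iff_mem_support k).2 ⟨γ, h, hk⟩⟩

theorem trace_mul_vecMulVec (A : Matrix (Fin p) (Fin p) ℝ) (v : Fin p → ℝ) :
    (A * Matrix.vecMulVec v v).trace = v ⬝ᵥ A *ᵥ v := by
  rw [Matrix.mul_vecMulVec, Matrix.trace_vecMulVec, dotProduct_comm]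

theorem dotProduct_evalMat_mulVec (P : PolyMat n p) (x : Fin n → ℝ) (v : Fin p → ℝ) :
    v ⬝ᵥ evalMat P x *ᵥ v = ∑ γ ∈ supp P, mono x γ * (v ⬝ᵥ coeffMat P γ *ᵥ v) := by
  rw [evalMat_eq_sum, Matrix.sum_mulVec, dotProduct_sum]
  simp only [Matrix.smul_mulVec, dotProduct_smul, smul_eq_mul]

theorem riesz_one (S : MatSeq n p) : riesz S 1 = (S 0).trace := by
  have h1 : supp (1 : PolyMat n p) ⊆ {0} := by
    intro α hα
    rw [mem_supp] at hα
    by_contra h0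
    refine hα ?_
    ext i j
    rw [Finset.mem_singleton] at h0
    rw [coeffMat, Matrix.map_apply, Matrix.one_apply]
    split_ifs <;> simp [MvPolynomial.coeff_one, Ne.symm h0]
  rw [riesz, Finset.sum_subset h1, Finset.sum_singleton]
  · have : coeffMat (1 : PolyMat n p) 0 = 1 := by
      ext i j
      rw [coeffMat, Matrix.map_apply, Matrix.one_apply, Matrix.one_apply]
      split_ifs <;> simp
    rw [this, Matrix.one_mul]
  · intro α _ hα
    rw [mem_supp, not_not] at hα
    rw [hα, Matrix.zero_mul, Matrix.trace_zero]

end PolynomialMatrices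

/-! ### Localizing matrices of atomic sequences -/

section Localizing

variable {n p q : ℕ} {S : MatSeq n p} {I : Finset (Fin n)} {r d s : ℕ} {v : Fin p → ℝ}

/-- The matrix `g ⊗ v ⊗ 1` with `q` columns. -/
def liftMat (q : ℕ) (g : exps I d → ℝ) (v : Fin p → ℝ) :
    Matrix (exps I d × (Fin p × Fin q)) (Fin q) ℝ :=
  Matrix.of fun x b => if x.2.2 = b then g x.1 * v x.2.1 else 0

theorem transpose_liftMat_mul (f g : exps I d → ℝ) (v w : Fin p → ℝ) :
    (liftMat q f v)ᵀ * liftMat q g w =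
      ((∑ α, f α * g α) * (v ⬝ᵥ w)) • (1 : Matrix (Fin q) (Fin q) ℝ) := by
  ext b b'
  simp only [Matrix.mul_apply, Matrix.transpose_apply, liftMat, Matrix.of_apply,
    Fintype.sum_prod_type, Matrix.smul_apply, Matrix.one_apply, smul_eq_mul, ite_mul, zero_mul,
    Finset.sum_ite_eq', Finset.mem_univ, if_true, mul_ite, mul_one, mul_zero]
  by_cases h : b' = b
  · subst h
    simp only [if_true, dotProduct, Finset.sum_mul_sum]
    exact Finset.sum_congr rfl fun α _ => Finset.sum_congr rfl fun a _ => by ring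
  · simp [h, Ne.symm h]

theorem liftMat_mul_mul_transpose_apply (g : exps I d → ℝ) (v : Fin p → ℝ)
    (A : Matrix (Fin q) (Fin q) ℝ) (x y : exps I d × (Fin p × Fin q)) :
    (liftMat q g v * A * (liftMat q g v)ᵀ) x y =
      g x.1 * v x.2.1 * A x.2.2 y.2.2 * (g y.1 * v y.2.1) := by
  simp [Matrix.mul_apply, liftMat]

/-- The degree bound keeps every exponent within `2r`, where `S` is atomic. It serves both the atoms
of a clique and a single Dirac sequence. -/
theorem localizingMatrix_eq_sum {κ : Type*} [Fintype κ] {x : κ → Fin n → ℝ} {c : κ → ℝ}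
    (h : ∀ α ∈ exps I (r + r), S α = (∑ j, c j * mono (x j) α) • Matrix.vecMulVec v v)
    (G : PolyMat n q) (hG : vars G ⊆ I) (hd : d + halfDeg G ≤ r) :
    localizingMatrix G S I d = ∑ j, c j •
      (liftMat q (fun α => mono (x j) α) v * evalMat G (x j) *
        (liftMat q (fun α => mono (x j) α) v)ᵀ) := by
  ext y z
  simp only [localizingMatrix, Matrix.of_apply, Matrix.sum_apply, Matrix.smul_apply,
    liftMat_mul_mul_transpose_apply, evalMat_eq_sum, Matrix.kroneckerMap_apply, smul_eq_mul]
  have h1 : ∀ γ ∈ supp G, (y.1 : Fin n →₀ ℕ) + (z.1 : Fin n →₀ ℕ) + γ ∈ exps I (r + r) := by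
    intro γ hγ
    have h2 := (mem_exps _ _ _).1 (add_mem_exps (add_mem_exps y.1.2 z.1.2)
      ((mem_exps I (deg G) γ).2 ⟨degree_le_deg hγ, (support_subset_vars hγ).trans hG⟩))
    have h3 := deg_le_two_mul_halfDeg G
    exact (mem_exps _ _ _).2 ⟨by omega, h2.2⟩
  rw [Finset.sum_congr rfl fun γ hγ => by rw [h _ (h1 γ hγ)]]
  simp only [Matrix.smul_apply, Matrix.vecMulVec_apply, smul_eq_mul, Finset.sum_mul,
    Finset.mul_sum, mono_add]
  rw [Finset.sum_comm]
  exact Finset.sum_congr rfl fun j _ => Finset.sum_congr rfl fun γ _ => by ring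

/-- Compressing the localizing matrix by the polynomial that is `1` at `x j` and `0` at the other
atoms leaves `c j • G(x j)`. -/
theorem IsAtomic.posSemidef_evalMat {e : ℕ} {x : Fin s → Fin n → ℝ} {c : Fin s → ℝ}
    (h : IsAtomic S I r e v x c) (hv : v ⬝ᵥ v = 1) {G : PolyMat n q} (hG : vars G ⊆ I)
    (hd : e + halfDeg G ≤ r) (hloc : (localizingMatrix G S I (r - halfDeg G)).PosSemidef)
    (j : Fin s) : (evalMat G (x j)).PosSemidef := by
  have h1 : (localizingMatrix G S I e).PosSemidef := hloc.submatrix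
    (fun y : exps I e × (Fin p × Fin q) => (⟨y.1, exps_mono I (by omega) y.1.2⟩, y.2))
  obtain ⟨f, hf⟩ := h.exists_interpolation j
  have h2 := h1.conjTranspose_mul_mul_same (liftMat q f v)
  rw [localizingMatrix_eq_sum h.seq_eq G hG hd, Matrix.conjTranspose_eq_transpose_of_trivial,
    Matrix.mul_sum, Matrix.sum_mul] at h2
  have h3 : ∀ i, (liftMat q f v)ᵀ * (c i • (liftMat q (fun α : exps I e => mono (x i) α) v *
      evalMat G (x i) * (liftMat q (fun α : exps I e => mono (x i) α) v)ᵀ)) * liftMat q f v =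
      if i = j then c i • evalMat G (x i) else 0 := by
    intro i
    have h4 := transpose_liftMat_mul (q := q) f (fun α => mono (x i) α) v v
    have h5 := congrArg Matrix.transpose h4
    rw [Matrix.transpose_mul, Matrix.transpose_transpose] at h5
    rw [hf i, hv] at h4 h5
    rw [Matrix.mul_smul, Matrix.smul_mul]
    simp only [Matrix.mul_assoc]
    rw [h5, ← Matrix.mul_assoc, ← Matrix.mul_assoc, h4]
    split_ifs <;> simp
  rw [Finset.sum_congr rfl fun i _ => h3 i, Finset.sum_ite_eq' Finset.univ j,
    if_pos (Finset.mem_univ j)] at h2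
  have h4 := h2.smul (inv_nonneg.2 (h.pos j).le)
  rwa [smul_smul, inv_mul_cancel₀ (h.pos j).ne', one_smul] at h4

/-- The vanishing minor on the monomials `1` and `x_i` says that the second moment of `x_i` is the
square of its mean. The variance is zero, so all atoms share this coordinate, and it can be read off
`S` without reference to the clique. -/
theorem IsAtomic.seq_single_eq {e : ℕ} {x : Fin s → Fin n → ℝ} {c : Fin s → ℝ}
    (h : IsAtomic S I r e v x c) (hS : S 0 = Matrix.vecMulVec v v) (hv : v ⬝ᵥ v = 1) (hr : 1 ≤ r)
    {I' : Finset (Fin n)} (hI : I' ⊆ I) (hrank : (momentMatrix S I' r).rank = 1) {i : Fin n}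
    (hi : i ∈ I') (j : Fin s) :
    S (Finsupp.single i 1) = x j i • Matrix.vecMulVec v v := by
  obtain ⟨a, ha⟩ : ∃ a, v a ≠ 0 := by
    by_contra! h0
    simp [dotProduct, h0] at hv
  have hmem : ∀ {I : Finset (Fin n)} {d : ℕ}, i ∈ I → 1 ≤ d → Finsupp.single i 1 ∈ exps I d := by
    intro I d hi hd
    have := (add_single_mem_exps (d := d - 1)).2 ⟨zero_mem_exps I (d - 1), hi⟩
    rwa [zero_add, Nat.sub_add_cancel hd] at this
  have hsum := h.sum_eq_one hS hv
  have h1 := h.seq_eq _ (hmem (hI hi) (by omega))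
  have h2 := h.seq_eq _ (add_mem_exps (hmem (hI hi) hr) (hmem (hI hi) hr))
  have h3 := minor_eq_zero_of_rank_le_one hrank (⟨0, zero_mem_exps _ _⟩, a)
    (⟨Finsupp.single i 1, hmem hi hr⟩, a)
  simp only [momentMatrix, Matrix.of_apply, zero_add, add_zero] at h3
  rw [h1, h2, hS] at h3
  simp only [mono_add, mono_single, Matrix.smul_apply, Matrix.vecMulVec_apply, smul_eq_mul] at h3
  rw [h1]
  simp only [mono_single]
  set m := ∑ j, c j * x j i with hm
  have h4 : ∑ j, c j * (x j i * x j i) = m * m := by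
    have : v a * v a * (v a * v a) ≠ 0 := by positivity
    apply mul_right_cancel₀ this
    linear_combination h3
  have h5 : ∑ j, c j * (x j i - m) ^ 2 = 0 := by
    have : ∀ j, c j * (x j i - m) ^ 2 =
        c j * (x j i * x j i) - 2 * m * (c j * x j i) + m * m * c j := fun j => by ring
    rw [Finset.sum_congr rfl fun j _ => this j, Finset.sum_add_distrib, Finset.sum_sub_distrib,
      ← Finset.mul_sum, ← Finset.mul_sum, h4, ← hm, hsum]
    ring
  have h6 := (Finset.sum_eq_zero_iff_of_nonneg fun j _ =>
    mul_nonneg (h.pos j).le (sq_nonneg _)).1 h5 j (Finset.mem_univ j)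
  rw [mul_eq_zero, or_iff_right (h.pos j).ne', sq_eq_zero_iff, sub_eq_zero] at h6
  rw [h6]

end Localizing

/-! ### The correlatively sparse relaxation -/

section Relaxation

variable {n p m : ℕ} {P : Problem n p m}

theorem Problem.CliqueDecomp.exists_subset (D : P.CliqueDecomp) {C : Finset (Fin n)}
    (hC : P.cspGraph.IsClique (C : Set (Fin n))) : ∃ ℓ, C ⊆ D.I ℓ := by
  obtain ⟨M, hCM, hM⟩ := Finite.exists_le_maximal
    (p := fun D : Finset (Fin n) => P.cspGraph.IsClique (D : Set (Fin n))) hC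
  obtain ⟨ℓ, rfl⟩ := (D.mem_range_I M).2 hM
  exact ⟨ℓ, hCM⟩

theorem Problem.CliqueDecomp.exists_mem (D : P.CliqueDecomp) (i : Fin n) : ∃ ℓ, i ∈ D.I ℓ := by
  obtain ⟨ℓ, h⟩ := D.exists_subset (C := {i}) (by simp)
  exact ⟨ℓ, h (Finset.mem_singleton_self i)⟩

theorem Problem.CliqueDecomp.exists_support_subset (D : P.CliqueDecomp) {α : Fin n →₀ ℕ}
    (hα : α ∈ supp P.F) : ∃ ℓ, α.support ⊆ D.I ℓ :=
  D.exists_subset fun _ hi _ hj hij => ⟨hij, Or.inl ⟨α, hα, hi, hj⟩⟩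

theorem Problem.halfDeg_F_le (P : Problem n p m) : halfDeg P.F ≤ P.rMin := le_max_left _ _

theorem Problem.halfDeg_G_le (P : Problem n p m) (k : Fin m) : halfDeg (P.G k) ≤ P.rMin :=
  (Finset.le_sup (f := fun k => halfDeg (P.G k)) (Finset.mem_univ k)).trans (le_max_right _ _)

theorem Problem.CliqueDecomp.halfDeg_le_dK (D : P.CliqueDecomp) {ℓ : Fin D.t} {k : Fin m}
    (hk : k ∈ D.J ℓ) : halfDeg (P.G k) ≤ D.dK ℓ :=
  (Finset.le_sup (f := fun k => halfDeg (P.G k)) hk).trans (le_max_right _ _)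

theorem Problem.CliqueDecomp.dK_le (D : P.CliqueDecomp) {r : ℕ} (hr : P.rMin ≤ r) (hr1 : 1 ≤ r)
    (ℓ : Fin D.t) : D.dK ℓ ≤ r :=
  max_le hr1 (Finset.sup_le fun k _ => (P.halfDeg_G_le k).trans hr)

/-- The sequence of moments of the matrix-valued measure `w wᵀ δ_x`. -/
def diracSeq (x : Fin n → ℝ) (w : Fin p → ℝ) : MatSeq n p :=
  fun α => mono x α • Matrix.vecMulVec w w

theorem riesz_diracSeq (x : Fin n → ℝ) (w : Fin p → ℝ) (Q : PolyMat n p) :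
    riesz (diracSeq x w) Q = w ⬝ᵥ evalMat Q x *ᵥ w := by
  rw [dotProduct_evalMat_mulVec, riesz]
  refine Finset.sum_congr rfl fun α _ => ?_
  rw [diracSeq, Matrix.mul_smul, Matrix.trace_smul, trace_mul_vecMulVec, smul_eq_mul]

theorem Problem.CliqueDecomp.diracSeq_mem_csFeasible (D : P.CliqueDecomp) {r : ℕ}
    (hr : P.rMin ≤ r) {x : Fin n → ℝ} (hx : x ∈ P.K) {w : Fin p → ℝ} (hw : w ⬝ᵥ w = 1) :
    diracSeq x w ∈ D.csFeasible r := by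
  refine ⟨fun α => ?_, fun ℓ => ?_, fun ℓ k hk => ?_, ?_⟩
  · rw [diracSeq, Matrix.IsSymm, Matrix.transpose_smul, Matrix.transpose_vecMulVec]
  · have h : momentMatrix (diracSeq x w) (D.I ℓ) r = Matrix.vecMulVec
        (fun y : exps (D.I ℓ) r × Fin p => mono x y.1 * w y.2)
        (star fun y : exps (D.I ℓ) r × Fin p => mono x y.1 * w y.2) := by
      ext y z
      simp only [momentMatrix, diracSeq, Matrix.of_apply, Matrix.smul_apply,
        Matrix.vecMulVec_apply, smul_eq_mul, mono_add, star_trivial]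
      ring
    rw [h]
    exact Matrix.posSemidef_vecMulVec_self_star _
  · have hk' := (P.halfDeg_G_le k).trans hr
    rw [localizingMatrix_eq_sum (r := r) (κ := Unit) (x := fun _ => x) (c := fun _ => 1) (v := w)
      (fun α _ => by simp [diracSeq]) (P.G k) (D.vars_subset ℓ k hk) (by omega)]
    simp only [Finset.univ_unique, Finset.sum_const, Finset.card_singleton, one_smul]
    exact (hx k).mul_mul_conjTranspose_same _
  · rw [riesz_diracSeq, evalMat_one, Matrix.one_mulVec, hw]

theorem Problem.CliqueDecomp.riesz_le_lambdaMin (D : P.CliqueDecomp) {r : ℕ} (hr : P.rMin ≤ r)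
    (hp : 0 < p) {S : MatSeq n p} (hS : D.IsCsOptimal r S) {x : Fin n → ℝ} (hx : x ∈ P.K) :
    riesz S P.F ≤ lambdaMin (evalMat P.F x) := by
  obtain ⟨w, hw, hw'⟩ := exists_unit_eigenvector hp (evalMat_isSymm P.F_symm x)
  have := hS.2 _ (D.diracSeq_mem_csFeasible hr hx hw)
  rwa [riesz_diracSeq, hw'] at this

theorem Problem.CliqueDecomp.IsCsOptimal.csValue_eq {D : P.CliqueDecomp} {r : ℕ} {S : MatSeq n p}
    (hS : D.IsCsOptimal r S) : D.csValue r = (riesz S P.F : EReal) :=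
  le_antisymm (iInf₂_le S hS.1) (le_iInf₂ fun S' hS' => EReal.coe_le_coe_iff.2 (hS.2 S' hS'))

/-- Marginals of a product of probability weights: expand the product of sums in which the factor
`i₀` carries the extra `g`. -/
theorem sum_pi_prod_mul {ι : Type*} [Fintype ι] [DecidableEq ι] {κ : ι → Type*}
    [∀ i, Fintype (κ i)] (c : ∀ i, κ i → ℝ) (hc : ∀ i, ∑ k, c i k = 1) (i₀ : ι) (g : κ i₀ → ℝ) :
    ∑ J : ∀ i, κ i, (∏ i, c i (J i)) * g (J i₀) = ∑ k, c i₀ k * g k := by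
  have h := Finset.prod_univ_sum (fun i => (Finset.univ : Finset (κ i)))
    (Function.update c i₀ fun k => c i₀ k * g k)
  rw [Fintype.prod_eq_single i₀ fun i hi => by rw [Function.update_of_ne hi, hc],
    Function.update_self, Fintype.piFinset_univ] at h
  rw [h]
  refine Finset.sum_congr rfl fun J _ => ?_
  rw [← Finset.mul_prod_erase _ _ (Finset.mem_univ i₀),
    ← Finset.mul_prod_erase _ (fun i => Function.update c i₀ _ i (J i)) (Finset.mem_univ i₀),
    Function.update_self]
  have h1 : ∏ i ∈ Finset.univ.erase i₀,
      Function.update c i₀ (fun k => c i₀ k * g k) i (J i) = ∏ i ∈ Finset.univ.erase i₀, c i (J i) :=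
    Finset.prod_congr rfl fun i hi => by rw [Function.update_of_ne (Finset.ne_of_mem_erase hi)]
  rw [h1]
  ring

theorem exists_eq_vecMulVec_self {A : Matrix (Fin p) (Fin p) ℝ} (hA : A.PosSemidef)
    (hrank : A.rank = 1) : ∃ v : Fin p → ℝ, A = Matrix.vecMulVec v v := by
  obtain ⟨V, hV⟩ : ∃ V : Matrix (Fin p) (Fin 1) ℝ, A = V * Vᵀ :=
    hrank ▸ exists_mul_transpose_eq_of_posSemidef hA
  refine ⟨fun a => V a 0, ?_⟩
  ext a b
  simp [hV, Matrix.mul_apply, Matrix.vecMulVec_apply]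

theorem dotProduct_self_eq_one_of_riesz {S : MatSeq n p} (h : riesz S 1 = 1) {v : Fin p → ℝ}
    (hS : S 0 = Matrix.vecMulVec v v) : v ⬝ᵥ v = 1 := by
  rwa [riesz_one, hS, Matrix.trace_vecMulVec] at h

/-- The value of the relaxation as a mean over all the ways to combine the atoms of the cliques. -/
theorem Problem.CliqueDecomp.riesz_eq_sum (D : P.CliqueDecomp) {r : ℕ} (hr : P.rMin ≤ r)
    {S : MatSeq n p} {v : Fin p → ℝ} {s : Fin D.t → ℕ} {e : Fin D.t → ℕ}
    {x : ∀ ℓ, Fin (s ℓ) → Fin n → ℝ} {c : ∀ ℓ, Fin (s ℓ) → ℝ}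
    (h : ∀ ℓ, IsAtomic S (D.I ℓ) r (e ℓ) v (x ℓ) (c ℓ)) (hc : ∀ ℓ, ∑ j, c ℓ j = 1)
    {z : (∀ ℓ, Fin (s ℓ)) → Fin n → ℝ} (hz : ∀ J ℓ, ∀ i ∈ D.I ℓ, z J i = x ℓ (J ℓ) i) :
    riesz S P.F = ∑ J : ∀ ℓ, Fin (s ℓ), (∏ ℓ, c ℓ (J ℓ)) * (v ⬝ᵥ evalMat P.F (z J) *ᵥ v) := by
  simp only [dotProduct_evalMat_mulVec, Finset.mul_sum]
  rw [Finset.sum_comm, riesz]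
  refine Finset.sum_congr rfl fun α hα => ?_
  obtain ⟨ℓ, hℓ⟩ := D.exists_support_subset hα
  have hdeg := (degree_le_deg hα).trans (deg_le_two_mul_halfDeg P.F)
  have hF := P.halfDeg_F_le.trans hr
  rw [(h ℓ).seq_eq α ((mem_exps _ _ _).2 ⟨by omega, hℓ⟩), Matrix.mul_smul, Matrix.trace_smul,
    trace_mul_vecMulVec, smul_eq_mul, ← sum_pi_prod_mul c hc ℓ fun k => mono (x ℓ k) α,
    Finset.sum_mul]
  refine Finset.sum_congr rfl fun J _ => ?_
  rw [mono_congr fun i hi => hz J ℓ i (hℓ hi), mul_assoc]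

end Relaxation

end PMO

theorem mainTheorem3 {n p m : ℕ} (P : PMO.Problem n p m) (D : P.CliqueDecomp)
    (r : ℕ) (hr : P.rMin ≤ r) (hr1 : 1 ≤ r)
    (S : PMO.MatSeq n p) (hS : D.IsCsOptimal r S)
    (hrank : (S 0).rank = 1)
    (hflat : ∀ ℓ, (PMO.momentMatrix S (D.I ℓ) r).rank =
      (PMO.momentMatrix S (D.I ℓ) (r - D.dK ℓ)).rank)
    (hinter : ∀ i j, i ≠ j → (D.I i ∩ D.I j).Nonempty →
      (PMO.momentMatrix S (D.I i ∩ D.I j) r).rank = 1) :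
    D.csValue r = P.optValue ∧
    (∀ ℓ, (PMO.extractedPoints S (D.I ℓ) r).Finite ∧
      (PMO.extractedPoints S (D.I ℓ) r).ncard = (PMO.momentMatrix S (D.I ℓ) r).rank) ∧
    (∃ v : Fin p → ℝ, S 0 = Matrix.vecMulVec v v) ∧
    ∀ v : Fin p → ℝ, S 0 = Matrix.vecMulVec v v →
      ∀ x : Fin n → ℝ, (∀ ℓ, (fun i : D.I ℓ => x i) ∈ PMO.extractedPoints S (D.I ℓ) r) →
        P.IsOptimalPoint x ∧
        Module.End.HasEigenvector (Matrix.toLin' (PMO.evalMat P.F x))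
          (PMO.lambdaMin (PMO.evalMat P.F x)) v := by
  open PMO in
  obtain ⟨-, hmom, hloc, hone⟩ := hS.1
  have hp : 0 < p := by
    rcases Nat.eq_zero_or_pos p with rfl | hp
    · have := (S 0).rank_le_card_width
      rw [hrank] at this
      simp at this
    · exact hp
  have hv₀ : ∃ v : Fin p → ℝ, S 0 = Matrix.vecMulVec v v := by
    -- The empty clique supplies an index `ℓ` even when `n = 0`.
    obtain ⟨ℓ, -⟩ := D.exists_subset (C := ∅) (by simp)
    refine exists_eq_vecMulVec_self ?_ hrank
    have := (hmom ℓ).submatrix fun a : Fin p => ((⟨0, zero_mem_exps _ _⟩ : exps (D.I ℓ) r), a)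
    convert this using 1
    ext a b
    simp [momentMatrix]
  have key : ∀ v : Fin p → ℝ, S 0 = Matrix.vecMulVec v v → D.csValue r = P.optValue ∧
      (∀ ℓ, (extractedPoints S (D.I ℓ) r).Finite ∧
        (extractedPoints S (D.I ℓ) r).ncard = (momentMatrix S (D.I ℓ) r).rank) ∧
      ∀ x : Fin n → ℝ, (∀ ℓ, (fun i : D.I ℓ => x i) ∈ extractedPoints S (D.I ℓ) r) →
        P.IsOptimalPoint x ∧
        Module.End.HasEigenvector (Matrix.toLin' (evalMat P.F x)) (lambdaMin (evalMat P.F x)) v := by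
    intro v hSv
    have hv := dotProduct_self_eq_one_of_riesz hone hSv
    have hdK := D.dK_le hr hr1
    have hdK1 : ∀ ℓ, 1 ≤ D.dK ℓ := fun ℓ => le_max_left _ _
    -- Since `1 ≤ D.dK ℓ ≤ r`, the truncated subtraction is exact and the rank is already attained
    -- at order `r - 1`.
    choose x c h using fun ℓ => exists_isAtomic (hmom ℓ)
      (by have := hdK ℓ; have := hdK1 ℓ; omega) (hflat ℓ) hSv hv
    have hc := fun ℓ => (h ℓ).sum_eq_one hSv hv
    have hvv : Matrix.vecMulVec v v ≠ 0 := fun h0 => by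
      have := congrArg Matrix.trace h0
      rw [Matrix.trace_vecMulVec, hv, Matrix.trace_zero] at this
      exact one_ne_zero this
    choose ℓ₀ hℓ₀ using D.exists_mem
    let z : (∀ ℓ, Fin (momentMatrix S (D.I ℓ) r).rank) → Fin n → ℝ :=
      fun J i => x (ℓ₀ i) (J (ℓ₀ i)) i
    -- Two cliques through `i` both give `S (e_i)` as their coordinate times `v vᵀ ≠ 0`, so the
    -- choice of `ℓ₀ i` is immaterial.
    have hz : ∀ J ℓ, ∀ i ∈ D.I ℓ, z J i = x ℓ (J ℓ) i := by
      intro J ℓ i hi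
      by_cases hne : ℓ₀ i = ℓ
      · subst hne
        rfl
      · have hi' := Finset.mem_inter.2 ⟨hℓ₀ i, hi⟩
        have hr' := hinter _ _ hne ⟨i, hi'⟩
        refine smul_left_injective ℝ hvv (Eq.trans ?_ ((h ℓ).seq_single_eq hSv hv hr1
          Finset.inter_subset_right hr' hi' (J ℓ)))
        exact ((h (ℓ₀ i)).seq_single_eq hSv hv hr1 Finset.inter_subset_left hr' hi' _).symm
    have hzK : ∀ J, z J ∈ P.K := by
      intro J k
      obtain ⟨ℓ, hk⟩ := D.J_cover k
      have h1 := D.halfDeg_le_dK hk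
      have h2 := hdK ℓ
      have h3 := (h ℓ).posSemidef_evalMat hv (D.vars_subset ℓ k hk) (by omega) (hloc ℓ k hk) (J ℓ)
      rw [evalMat_eq_sum] at h3 ⊢
      rwa [Finset.sum_congr rfl fun γ hγ => by
        rw [mono_congr fun i hi => hz J ℓ i (D.vars_subset ℓ k hk (support_subset_vars hγ hi))]]
    have hle := fun J => D.riesz_le_lambdaMin hr hp hS (hzK J)
    have hle' := fun J => lambdaMin_le_dotProduct (evalMat_isSymm P.F_symm (z J)) hv
    have hmean := D.riesz_eq_sum hr h hc hz
    have hprod : ∑ J : ∀ ℓ, Fin (momentMatrix S (D.I ℓ) r).rank, ∏ ℓ, c ℓ (J ℓ) = 1 := by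
      have := Finset.prod_univ_sum (fun ℓ => (Finset.univ :
        Finset (Fin (momentMatrix S (D.I ℓ) r).rank))) c
      rw [Fintype.piFinset_univ] at this
      rw [← this]
      exact Finset.prod_eq_one fun ℓ _ => hc ℓ
    -- The deviations from the mean are nonnegative by `hle` and `hle'`, have positive weights and
    -- sum to zero.
    have heq : ∀ J, v ⬝ᵥ evalMat P.F (z J) *ᵥ v = riesz S P.F := by
      have h0 : ∑ J : ∀ ℓ, Fin (momentMatrix S (D.I ℓ) r).rank, (∏ ℓ, c ℓ (J ℓ)) *
          (v ⬝ᵥ evalMat P.F (z J) *ᵥ v - riesz S P.F) = 0 := by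
        simp only [mul_sub, Finset.sum_sub_distrib, ← Finset.sum_mul]
        rw [← hmean, hprod, one_mul, sub_self]
      intro J
      have hpos : ∀ J : ∀ ℓ, Fin (momentMatrix S (D.I ℓ) r).rank, 0 < ∏ ℓ, c ℓ (J ℓ) :=
        fun J => Finset.prod_pos fun ℓ _ => (h ℓ).pos _
      have h1 := (Finset.sum_eq_zero_iff_of_nonneg fun J _ => mul_nonneg (hpos J).le
        (sub_nonneg.2 ((hle J).trans (hle' J)))).1 h0 J (Finset.mem_univ J)
      rwa [mul_eq_zero, or_iff_right (hpos J).ne', sub_eq_zero] at h1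
    have hmin : ∀ J, lambdaMin (evalMat P.F (z J)) = riesz S P.F := fun J =>
      le_antisymm ((hle' J).trans (heq J).le) (hle J)
    have hopt : P.optValue = (riesz S P.F : EReal) := by
      obtain ⟨J, -⟩ : (Finset.univ : Finset (∀ ℓ, Fin (momentMatrix S (D.I ℓ) r).rank)).Nonempty :=
        Finset.nonempty_of_sum_ne_zero (by rw [hprod]; exact one_ne_zero)
      refine le_antisymm ?_ (le_iInf₂ fun y hy =>
        EReal.coe_le_coe_iff.2 (D.riesz_le_lambdaMin hr hp hS hy))
      rw [← hmin J]
      exact iInf₂_le (z J) (hzK J)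
    refine ⟨hS.csValue_eq.trans hopt.symm, fun ℓ => ⟨?_, (h ℓ).ncard_extractedPoints⟩, ?_⟩
    · rw [(h ℓ).extractedPoints_eq]
      exact Set.finite_range _
    · intro y hy
      -- Every point assembled from extracted points is some `z J`, as the cliques cover all
      -- variables.
      choose J hJ using fun ℓ => ((h ℓ).mem_extractedPoints _).1 (hy ℓ)
      obtain rfl : y = z J := funext fun i => congrFun (hJ (ℓ₀ i)) ⟨i, hℓ₀ i⟩
      exact ⟨⟨hzK J, by rw [hmin, hopt]⟩, hasEigenvector_lambdaMin (evalMat_isSymm P.F_symm _) hv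
        ((heq J).trans (hmin J).symm)⟩
  obtain ⟨v, hSv⟩ := hv₀
  exact ⟨(key v hSv).1, (key v hSv).2.1, ⟨v, hSv⟩, fun w hw => (key w hw).2.2⟩
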